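/- \textbf{Notation.} $\mathrm{SO}(3)=\{R\in\mathbb R^{3\times 3}: R^\top R=I,\ \det R=1\}$; $\omega\mapsto\omega^\wedge$ is the usual isomorphism $\mathbb R^3\to\mathfrak{so}(3)$, $\omega^\wedge y=\omega\times y$; $\mathrm{Ad}_R(\Omega)=R\Omega R^\top$; $\|\cdot\|_F$ is the Frobenius norm. For $R\in\mathrm{SO}(3)$ with $\mathrm{tr}(R)\neq-1$ let $\log(I)=0$ and $\log(R)=\frac{\theta}{2\sin\theta}(R-R^\top)$ for $R\ne I$, where $\theta=\arccos\frac{\mathrm{tr}(R)-1}{2}$. Let $t_0\in\mathbb R$, $\omega_d>0$, and let $R_a(t)\in\mathrm{SO}(3)$, $t\ge t_0$, be a target attitude with $\dot R_a=R_a\Omega_a$, $\Omega_a=\Omega_a^u+\Omega_a^k$, where $\Omega_a^u(t)=\omega^u(t)^\wedge$ is the unknown part, with $\|\omega^u(t)\|\le\omega_d$ for $t\ge t_0$, and $\Omega_a^k(t)\in\mathfrak{so}(3)$ is the known part. Write $m_d(t)$ for the first column of $R_a(t)$. For $\delta\ge 0$ let $\mathcal M_\delta$ (at time $t$) be the set of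 $R\in\mathrm{SO}(3)$ whose first column $x$ satisfies $\arccos(x^\top m_d(t))\le\delta$. Two robots $\ell\in\{i,j\}$ move for $t\ge t_0$ according to $\dot p_\ell=R_\ell v$, $\dot R_\ell=R_\ell\Omega_\ell$, with $p_\ell(t)\in\mathbb R^3$, $R_\ell(t)\in\mathrm{SO}(3)$, the same constant $v\in\mathbb R^3$ with $\|v\|=1$, and the control law $$\Omega_\ell=-k_w\log(R_e^\ell)+\mathrm{Ad}_{(R_e^\ell)^\top}(\Omega_a^k),\qquad R_e^\ell=R_a^\top R_\ell,\qquad k_w=\sqrt2\,\frac{\omega_d}{\mu^*},\qquad 0<\mu^*\le\delta^*.$$ \textbf{Proposition.} There are constants $\delta_0,\alpha,c>0$, independent of all the data above, such that the following holds whenever $\delta^*\le\delta_0$. Suppose that both robots start in $\mathcal M_{\delta^*}$ with attitude errors at most $\delta^*$, that is, for $\ell\in\{i,j\}$, $$R_\ell(t_0)\in\mathcal M_{\delta^*},\qquad \mathrm{tr}(R_e^\ell(t_0))\ne-1,\qquad \|\log(R_e^\ell(t_0))\|_F\le\delta^*.$$ Then the relative attitude $R_{ij}=R_j^\top R_i$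 converges exponentially to the identity: for all $t\ge t_0$ one has $\mathrm{tr}(R_{ij}(t))\neq-1$ and $$\|\log(R_{ij}(t))\|_F\le\alpha\,\|\log(R_{ij}(t_0))\|_F\,e^{-c\,k_w(t-t_0)}.$$ If moreover both attitude errors are initially within the design value $\mu^*$, that is, $\|\log(R_e^\ell(t_0))\|_F\le\mu^*$ for $\ell\in\{i,j\}$, then the relative position $p_{ij}=p_i-p_j$ satisfies, for all $t\ge t_0$, $$\|p_{ij}(t)-p_{ij}(t_0)\|\le\frac{2\sqrt3\,\mu^*}{k_w}.$$ -/

import Mathlib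

open Matrix

/-- Vectors of `ℝ³` with the Euclidean norm. -/
abbrev Vec3 : Type := EuclideanSpace ℝ (Fin 3)

/-- Real `3 × 3` matrices. -/
abbrev Mat3 : Type := Matrix (Fin 3) (Fin 3) ℝ

/-- `SO(3)`, as the set of real matrices `R` with `Rᵀ R = 1` and `det R = 1`. -/
def SO3 : Set Mat3 := {R | Rᵀ * R = 1 ∧ R.det = 1}

/-- The hat map `ℝ³ → 𝔰𝔬(3)`; every element of `𝔰𝔬(3)` is `hat ω` for exactly one `ω`
(its vee vector). -/
def hat (w : Vec3) : Mat3 :=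
  !![0, -(w 2), w 1;
     w 2, 0, -(w 0);
     -(w 1), w 0, 0]

/-- The Frobenius norm `√(tr(Aᵀ A))`. -/
noncomputable def frobNorm (A : Mat3) : ℝ := Real.sqrt (Aᵀ * A).trace

/-- The rotation angle `θ = arccos((tr R - 1) / 2) ∈ [0, π]`. -/
noncomputable def rotAngle (R : Mat3) : ℝ := Real.arccos ((R.trace - 1) / 2)

open Classical in
/-- The logarithm of a rotation matrix, meaningful for `R ∈ SO(3)` with `tr R ≠ -1`:
`0` if `R = 1`, and `θ / (2 sin θ) • (R - Rᵀ)` otherwise. -/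
noncomputable def logSO3 (R : Mat3) : Mat3 :=
  if R = 1 then 0
  else (rotAngle R / (2 * Real.sin (rotAngle R))) • (R - Rᵀ)

/-- The adjoint map `Ad_R(Ω) = R Ω Rᵀ`. -/
def adjointMap (R Om : Mat3) : Mat3 := R * Om * Rᵀ

/-- The geodesic distance `‖log(Aᵀ B)‖_F` on `SO(3)`, meaningful when `tr(Aᵀ B) ≠ -1`. -/
noncomputable def distSO3 (A B : Mat3) : ℝ := frobNorm (logSO3 (Aᵀ * B))

/-- The target attitude set: the attitudes `R ∈ SO(3)` whose first column makes an angle at most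
`δ` with the first column (the desired direction) of the target attitude `Ra`. -/
def targetSet (Ra : Mat3) (δ : ℝ) : Set Mat3 :=
  {R | R ∈ SO3 ∧ Real.arccos (∑ a, R a 0 * Ra a 0) ≤ δ}

/-- The control law `Ω(R_e) = -k log(R_e) + Ad_{R_eᵀ}(Ω_a^k)`, where `R_e = Raᵀ R` and `Ω_a^k`
is the known part of the velocity of the target. -/
noncomputable def controlLaw (k : ℝ) (Ra R Omk : Mat3) : Mat3 :=
  -(k • logSO3 (Raᵀ * R)) + adjointMap (Raᵀ * R)ᵀ Omk

/-- `Ra` is, for times `t ≥ t₀`, a target attitude in `SO(3)` with `Ṙ_a = R_a Ω_a`, where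
`Ω_a = Ω_a^u + Ω_a^k` has vee vectors `wu` (unknown part) and `wk` (known part), and the norm of
the unknown part is at most `ωd`. -/
structure IsTarget (t₀ ωd : ℝ) (wu wk : ℝ → Vec3) (Ra : ℝ → Mat3) : Prop where
  mem_SO3 : ∀ t, t₀ ≤ t → Ra t ∈ SO3
  deriv_eq : ∀ t, t₀ ≤ t → ∀ a b,
    HasDerivWithinAt (fun s => Ra s a b) ((Ra t * (hat (wu t) + hat (wk t))) a b) (Set.Ici t₀) t
  unknown_le : ∀ t, t₀ ≤ t → ‖wu t‖ ≤ ωd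

/-- `(p, R)` is, for times `t ≥ t₀`, a trajectory of the kinematics `ṗ = R v`, `Ṙ = R Ω` in
`ℝ³ × SO(3)` under the above control law. -/
structure IsControlledRobot (t₀ k : ℝ) (v : Vec3) (wk : ℝ → Vec3) (Ra : ℝ → Mat3)
    (p : ℝ → Vec3) (R : ℝ → Mat3) : Prop where
  mem_SO3 : ∀ t, t₀ ≤ t → R t ∈ SO3
  deriv_position : ∀ t, t₀ ≤ t →
    HasDerivWithinAt p (WithLp.toLp 2 (R t *ᵥ WithLp.ofLp v)) (Set.Ici t₀) t
  deriv_attitude : ∀ t, t₀ ≤ t → ∀ a b,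
    HasDerivWithinAt (fun s => R s a b)
      ((R t * controlLaw k (Ra t) (R t) (hat (wk t))) a b) (Set.Ici t₀) t

/-! Write `A = Raᵀ Ri` and `B = Raᵀ Rj` for the attitude errors. The proof follows the squared
chordal distance `‖Ri - Rj‖² = ‖A - B‖² = 2 (3 - tr(Rjᵀ Ri))`, which is smooth, unlike the angle.

Each error stays small. In the derivative of `tr(Raᵀ R)` the known velocity cancels, the unknown one
contributes at most `2 ωd sin θ`, and the feedback contributes `2 k θ sin θ`. So the trace cannot
decrease where `k θ ≥ ωd`, and every ball of angle `θ₀` with `k θ₀ ≥ ωd` is invariant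
(`rotAngle_error_le`).

In the relative motion the target velocity drops out: the derivative of `tr(Rjᵀ Ri)` is `k tr(Bᵀ A
(log B - log A))` (`trace_relative_deriv`). Near the identity `A - B` is almost skew and `log` is
strongly monotone in the skew part, so this trace is at least `3/4 ‖A - B‖²`
(`trace_relative_mul_log_sub_ge`). Hence the squared distance decays at rate `3/2 k`.

Since `4θ²/π² ≤ 3 - tr R ≤ θ²`, decay passes to the angle at the cost of a factor `π/2`. Integrating
the chordal bound gives the position estimate. -/

section
open scoped Matrix.Norms.Frobenius

/-! ### Frobenius geometry and the skew/symmetric splitting -/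

/-- The Frobenius inner product `tr(Aᵀ B)`. -/
def frobInner (A B : Mat3) : ℝ := (Aᵀ * B).trace

theorem frobInner_eq_sum (A B : Mat3) : frobInner A B = ∑ i, ∑ j, A i j * B i j := by
  simp only [frobInner, trace, diag_apply, mul_apply, transpose_apply]
  exact Finset.sum_comm

theorem frobInner_comm (A B : Mat3) : frobInner A B = frobInner B A := by
  simp only [frobInner_eq_sum, mul_comm]

theorem frobInner_add_left (A B C : Mat3) :
    frobInner (A + B) C = frobInner A C + frobInner B C := by
  simp [frobInner, Matrix.add_mul]

theorem frobInner_add_right (A B C : Mat3) :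
    frobInner A (B + C) = frobInner A B + frobInner A C := by
  simp [frobInner, Matrix.mul_add]

theorem frobInner_sub_left (A B C : Mat3) :
    frobInner (A - B) C = frobInner A C - frobInner B C := by
  simp [frobInner, Matrix.sub_mul]

theorem frobInner_sub_right (A B C : Mat3) :
    frobInner A (B - C) = frobInner A B - frobInner A C := by
  simp [frobInner, Matrix.mul_sub]

theorem frobInner_smul_left (c : ℝ) (A B : Mat3) :
    frobInner (c • A) B = c * frobInner A B := by
  simp [frobInner]

theorem frobInner_smul_right (c : ℝ) (A B : Mat3) :
    frobInner A (c • B) = c * frobInner A B := by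
  simp [frobInner]

theorem frobInner_transpose (A B : Mat3) : frobInner Aᵀ Bᵀ = frobInner A B := by
  simp only [frobInner_eq_sum, transpose_apply]
  exact Finset.sum_comm

theorem frobenius_norm_sq (A : Mat3) : ‖A‖ ^ 2 = frobInner A A := by
  have h : 0 ≤ ∑ i, ∑ j, ‖A i j‖ ^ 2 := by positivity
  rw [frobenius_norm_def, frobInner_eq_sum, ← Real.sqrt_eq_rpow]
  norm_cast at *
  rw [Real.sq_sqrt (by simpa using h)]
  simp [sq]

theorem frobNorm_eq_norm (A : Mat3) : frobNorm A = ‖A‖ := by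
  rw [frobNorm, ← frobInner, ← frobenius_norm_sq, Real.sqrt_sq (norm_nonneg _)]

theorem abs_frobInner_le (A B : Mat3) : |frobInner A B| ≤ ‖A‖ * ‖B‖ := by
  apply abs_le_of_sq_le_sq _ (by positivity)
  rw [mul_pow, frobenius_norm_sq, frobenius_norm_sq]
  simp only [frobInner_eq_sum, ← Finset.sum_product', Finset.univ_product_univ, ← sq]
  exact Finset.sum_mul_sq_le_sq_mul_sq _ _ _

/-- The skew-symmetric part of a matrix. -/
noncomputable def skewPart (A : Mat3) : Mat3 := (1 / 2 : ℝ) • (A - Aᵀ)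

/-- The symmetric part of a matrix. -/
noncomputable def symPart (A : Mat3) : Mat3 := (1 / 2 : ℝ) • (A + Aᵀ)

theorem skewPart_sub (A B : Mat3) : skewPart (A - B) = skewPart A - skewPart B := by
  simp only [skewPart, transpose_sub]; module

theorem norm_sq_eq_skewPart_add_symPart (A : Mat3) :
    ‖A‖ ^ 2 = ‖skewPart A‖ ^ 2 + ‖symPart A‖ ^ 2 := by
  simp only [frobenius_norm_sq, skewPart, symPart, frobInner_smul_left, frobInner_smul_right,
    frobInner_add_left, frobInner_add_right, frobInner_sub_left, frobInner_sub_right,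
    frobInner_transpose]
  ring

theorem norm_skewPart_le (A : Mat3) : ‖skewPart A‖ ≤ ‖A‖ := by
  rw [← sq_le_sq₀ (norm_nonneg _) (norm_nonneg _)]
  nlinarith [norm_sq_eq_skewPart_add_symPart A, sq_nonneg ‖symPart A‖]

theorem transpose_skewPart (A : Mat3) : (skewPart A)ᵀ = -skewPart A := by
  simp [skewPart, transpose_sub, ← smul_neg]

theorem trace_mul_of_skew {M : Mat3} (hM : Mᵀ = -M) (Q : Mat3) :
    (Q * M).trace = -frobInner (skewPart Q) M := by
  have h1 : (Q * M).trace = frobInner Qᵀ M := by simp [frobInner]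
  have h2 : frobInner Qᵀ M = -frobInner Q M := by
    rw [← frobInner_transpose, transpose_transpose, hM, ← neg_one_smul ℝ M, frobInner_smul_right]
    ring
  rw [skewPart, frobInner_smul_left, frobInner_sub_left, h1]
  linarith

/-! ### Trace, angle and logarithm of a rotation -/

theorem SO3_transpose_mul {R : Mat3} (h : R ∈ SO3) : Rᵀ * R = 1 := h.1

theorem SO3_mul_transpose {R : Mat3} (h : R ∈ SO3) : R * Rᵀ = 1 := mul_eq_one_comm.mp h.1

theorem SO3_transpose_mul_mem {A B : Mat3} (hA : A ∈ SO3) (hB : B ∈ SO3) : Aᵀ * B ∈ SO3 := by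
  refine ⟨?_, ?_⟩
  · rw [transpose_mul, transpose_transpose, Matrix.mul_assoc, ← Matrix.mul_assoc A,
      SO3_mul_transpose hA, Matrix.one_mul, SO3_transpose_mul hB]
  · rw [det_mul, det_transpose, hA.2, hB.2, one_mul]

theorem norm_sub_sq_of_SO3 {A B : Mat3} (hA : A ∈ SO3) (hB : B ∈ SO3) :
    ‖A - B‖ ^ 2 = 2 * (3 - (Bᵀ * A).trace) := by
  have h : frobInner A A = 3 ∧ frobInner B B = 3 := by
    simp [frobInner, hA.1, hB.1]
  rw [frobenius_norm_sq, frobInner_sub_left, frobInner_sub_right, frobInner_sub_right,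
    frobInner_comm A B, h.1, h.2, frobInner]
  ring

theorem one_mem_SO3 : (1 : Mat3) ∈ SO3 := by simp [SO3]

theorem norm_sub_one_sq_of_SO3 {R : Mat3} (h : R ∈ SO3) : ‖R - 1‖ ^ 2 = 2 * (3 - R.trace) := by
  simpa using norm_sub_sq_of_SO3 h one_mem_SO3

/-- The adjugate of a rotation is its transpose, so the second elementary symmetric function
`(tr(R)² - tr(R²)) / 2` equals `tr R`. -/
theorem trace_sq_of_SO3 {R : Mat3} (h : R ∈ SO3) :
    (R * R).trace = R.trace ^ 2 - 2 * R.trace := by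
  have h1 : R.adjugate = Rᵀ := by
    have := congrArg (fun X => Rᵀ * X) (mul_adjugate R)
    simpa [← Matrix.mul_assoc, h.1, h.2] using this
  have h2 : R.adjugate.trace = R.trace := by rw [h1, trace_transpose]
  rw [adjugate_fin_three, trace_fin_three] at h2
  simp only [of_apply, cons_val', cons_val_zero, cons_val_one, cons_val, cons_val_fin_one] at h2
  simp only [trace_fin_three, mul_apply, Fin.sum_univ_three] at h2 ⊢
  linear_combination (-2) * h2

theorem norm_skewPart_sq_of_SO3 {R : Mat3} (h : R ∈ SO3) :
    2 * ‖skewPart R‖ ^ 2 = (3 - R.trace) * (1 + R.trace) := by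
  have h1 : frobInner R R = 3 := by simp [frobInner, h.1]
  have h2 : frobInner Rᵀ R = R.trace ^ 2 - 2 * R.trace := by
    rw [← trace_sq_of_SO3 h, frobInner, transpose_transpose]
  rw [frobenius_norm_sq, skewPart, frobInner_smul_left, frobInner_smul_right, frobInner_sub_left,
    frobInner_sub_right, frobInner_sub_right, frobInner_transpose, frobInner_comm R Rᵀ, h1, h2]
  ring

theorem trace_le_of_SO3 {R : Mat3} (h : R ∈ SO3) : R.trace ≤ 3 := by
  nlinarith [norm_sub_one_sq_of_SO3 h, sq_nonneg ‖R - 1‖]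

theorem neg_one_le_trace_of_SO3 {R : Mat3} (h : R ∈ SO3) : -1 ≤ R.trace := by
  by_contra hlt
  nlinarith [norm_skewPart_sq_of_SO3 h, sq_nonneg ‖skewPart R‖, trace_le_of_SO3 h]

theorem rotAngle_nonneg (R : Mat3) : 0 ≤ rotAngle R := Real.arccos_nonneg _

theorem rotAngle_le_pi (R : Mat3) : rotAngle R ≤ Real.pi := Real.arccos_le_pi _

theorem sin_rotAngle_nonneg (R : Mat3) : 0 ≤ Real.sin (rotAngle R) :=
  Real.sin_nonneg_of_nonneg_of_le_pi (rotAngle_nonneg R) (rotAngle_le_pi R)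

theorem trace_eq_of_SO3 {R : Mat3} (h : R ∈ SO3) :
    R.trace = 1 + 2 * Real.cos (rotAngle R) := by
  rw [rotAngle, Real.cos_arccos]
  · ring
  · linarith [neg_one_le_trace_of_SO3 h]
  · linarith [trace_le_of_SO3 h]

theorem norm_skewPart_of_SO3 {R : Mat3} (h : R ∈ SO3) :
    ‖skewPart R‖ = Real.sqrt 2 * Real.sin (rotAngle R) := by
  rw [← sq_eq_sq₀ (norm_nonneg _) (mul_nonneg (Real.sqrt_nonneg _) (sin_rotAngle_nonneg R)),
    mul_pow, Real.sq_sqrt zero_le_two]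
  have := norm_skewPart_sq_of_SO3 h
  rw [trace_eq_of_SO3 h] at this
  nlinarith [Real.sin_sq_add_cos_sq (rotAngle R)]

theorem logSO3_eq_smul_skewPart (R : Mat3) :
    logSO3 R = (rotAngle R / Real.sin (rotAngle R)) • skewPart R := by
  rw [logSO3, skewPart]
  split_ifs with h
  · simp [h]
  · rw [smul_smul]; congr 1; ring

theorem transpose_logSO3 (R : Mat3) : (logSO3 R)ᵀ = -logSO3 R := by
  rw [logSO3_eq_smul_skewPart, transpose_smul, transpose_skewPart, smul_neg]

theorem rotAngle_lt_pi {R : Mat3} (h : R ∈ SO3) (htr : R.trace ≠ -1) : rotAngle R < Real.pi := by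
  refine lt_of_le_of_ne (rotAngle_le_pi R) fun hpi => htr ?_
  rw [trace_eq_of_SO3 h, hpi, Real.cos_pi]; norm_num

theorem frobNorm_logSO3 {R : Mat3} (h : R ∈ SO3) (htr : R.trace ≠ -1) :
    frobNorm (logSO3 R) = Real.sqrt 2 * rotAngle R := by
  rw [frobNorm_eq_norm, logSO3_eq_smul_skewPart, norm_smul, norm_skewPart_of_SO3 h,
    Real.norm_of_nonneg (div_nonneg (rotAngle_nonneg R) (sin_rotAngle_nonneg R))]
  rcases (rotAngle_nonneg R).eq_or_lt with h0 | h0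
  · simp [← h0]
  · have := (Real.sin_pos_of_pos_of_lt_pi h0 (rotAngle_lt_pi h htr)).ne'
    field_simp

theorem sub_trace_le_rotAngle_sq {R : Mat3} (h : R ∈ SO3) : 3 - R.trace ≤ rotAngle R ^ 2 := by
  rw [trace_eq_of_SO3 h]
  linarith [@Real.one_sub_sq_div_two_le_cos (rotAngle R)]

theorem rotAngle_sq_le {R : Mat3} (h : R ∈ SO3) :
    rotAngle R ^ 2 ≤ (Real.pi / 2) ^ 2 * (3 - R.trace) := by
  have h1 := Real.cos_le_one_sub_mul_cos_sq (x := rotAngle R)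
    (by rw [abs_of_nonneg (rotAngle_nonneg R)]; exact rotAngle_le_pi R)
  have h2 := mul_le_mul_of_nonneg_left h1 (sq_nonneg Real.pi)
  have h3 : Real.pi ^ 2 * (1 - 2 / Real.pi ^ 2 * rotAngle R ^ 2) =
      Real.pi ^ 2 - 2 * rotAngle R ^ 2 := by
    field_simp
  rw [trace_eq_of_SO3 h]
  linarith

theorem norm_sub_one_le_of_SO3 {R : Mat3} (h : R ∈ SO3) :
    ‖R - 1‖ ≤ Real.sqrt 2 * rotAngle R := by
  rw [← sq_le_sq₀ (norm_nonneg _) (mul_nonneg (Real.sqrt_nonneg _) (rotAngle_nonneg R)),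
    mul_pow, Real.sq_sqrt zero_le_two, norm_sub_one_sq_of_SO3 h]
  linarith [sub_trace_le_rotAngle_sq h]

/-! ### Strong monotonicity of the logarithm near the identity -/

theorem sin_sub_sin_bounds {x y : ℝ} (hy : 0 ≤ y) (hyx : y ≤ x) (hx : x ≤ 1 / 10) :
    Real.sin x - Real.sin y ≤ x - y ∧ x - y ≤ 2 * (Real.sin x - Real.sin y) := by
  -- In `sin x - sin y = 2 sin((x-y)/2) cos((x+y)/2)`, Jordan's inequality and the cosine bound give
  -- the factor `3/5 * 9/10 ≥ 1/2`.
  have h1 := Real.mul_le_sin (x := (x - y) / 2) (by linarith) (by linarith [Real.pi_gt_three])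
  have h2 := Real.sin_le (x := (x - y) / 2) (by linarith)
  have h3 := @Real.one_sub_sq_div_two_le_cos ((x + y) / 2)
  have h4 := Real.cos_le_one ((x + y) / 2)
  have h5 : (3 / 5 : ℝ) ≤ 2 / Real.pi := by
    rw [le_div_iff₀ Real.pi_pos]; linarith [Real.pi_lt_d2]
  have h6 : (9 / 10 : ℝ) ≤ Real.cos ((x + y) / 2) := by nlinarith
  have h7 : 3 / 5 * ((x - y) / 2) ≤ Real.sin ((x - y) / 2) :=
    (mul_le_mul_of_nonneg_right h5 (by linarith)).trans h1
  rw [Real.sin_sub_sin]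
  constructor <;> nlinarith

theorem sub_mul_sin_sub_sin_bounds {x y : ℝ} (hx0 : 0 ≤ x) (hy0 : 0 ≤ y)
    (hx : x ≤ 1 / 10) (hy : y ≤ 1 / 10) :
    (Real.sin x - Real.sin y) ^ 2 ≤ (x - y) * (Real.sin x - Real.sin y) ∧
      (x - y) ^ 2 ≤ 4 * (Real.sin x - Real.sin y) ^ 2 := by
  rcases le_total y x with h | h
  · obtain ⟨h1, h2⟩ := sin_sub_sin_bounds hy0 h hx
    constructor <;> nlinarith
  · obtain ⟨h1, h2⟩ := sin_sub_sin_bounds hx0 h hy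
    constructor <;> nlinarith

theorem exists_logSO3_eq_smul {R : Mat3} (h : R ∈ SO3) (hθ : rotAngle R ≤ 1 / 10) :
    ∃ f : ℝ, 1 ≤ f ∧ f ≤ 2 ∧ logSO3 R = f • skewPart R ∧
      f * Real.sin (rotAngle R) = rotAngle R := by
  rcases (rotAngle_nonneg R).eq_or_lt with h0 | h0
  -- At angle `0` the quotient `θ / sin θ` evaluates to `0`, so the limit value `1` is used instead.
  · refine ⟨1, le_rfl, one_le_two, ?_, by simp [← h0]⟩
    have h1 : R = 1 := by
      have := norm_sub_one_le_of_SO3 h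
      rwa [← h0, mul_zero, norm_le_zero_iff, sub_eq_zero] at this
    simp [h1, logSO3, skewPart]
  · have hs : 0 < Real.sin (rotAngle R) :=
      Real.sin_pos_of_pos_of_lt_pi h0 (by linarith [Real.pi_gt_three])
    obtain ⟨h1, h2⟩ := sin_sub_sin_bounds le_rfl h0.le hθ
    simp only [Real.sin_zero, sub_zero] at h1 h2
    exact ⟨_, (one_le_div hs).mpr h1, (div_le_iff₀ hs).mpr h2, logSO3_eq_smul_skewPart R,
      div_mul_cancel₀ _ hs.ne'⟩

/-- Monotonicity and Lipschitz continuity of a radial map `f • X`, in terms of the norms. -/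
theorem radial_bounds {X Y : Mat3} {f g : ℝ} (hf : 1 ≤ f) (hf2 : f ≤ 2) (hg : 1 ≤ g) (hg2 : g ≤ 2)
    (hmono : (‖X‖ - ‖Y‖) ^ 2 ≤ (f * ‖X‖ - g * ‖Y‖) * (‖X‖ - ‖Y‖))
    (hlip : (f * ‖X‖ - g * ‖Y‖) ^ 2 ≤ 4 * (‖X‖ - ‖Y‖) ^ 2) :
    ‖X - Y‖ ^ 2 ≤ frobInner (X - Y) (f • X - g • Y) ∧ ‖f • X - g • Y‖ ≤ 2 * ‖X - Y‖ := by
  -- All three quantities split into a radial part and a multiple of this Cauchy–Schwarz defect; `2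
  -- ≤ f + g` and `f g ≤ 4` then handle the defect.
  have hXY : 0 ≤ ‖X‖ * ‖Y‖ - frobInner X Y :=
    sub_nonneg.mpr ((le_abs_self _).trans (abs_frobInner_le X Y))
  have e1 : ‖X - Y‖ ^ 2 = (‖X‖ - ‖Y‖) ^ 2 + 2 * (‖X‖ * ‖Y‖ - frobInner X Y) := by
    rw [sub_sq, frobenius_norm_sq, frobenius_norm_sq, frobenius_norm_sq]
    simp only [frobInner_sub_left, frobInner_sub_right, frobInner_comm Y X]
    ring
  have e2 : frobInner (X - Y) (f • X - g • Y) = (f * ‖X‖ - g * ‖Y‖) * (‖X‖ - ‖Y‖)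
      + (f + g) * (‖X‖ * ‖Y‖ - frobInner X Y) := by
    simp only [frobInner_sub_left, frobInner_sub_right, frobInner_smul_right, frobInner_comm Y X,
      ← frobenius_norm_sq]
    ring
  have e3 : ‖f • X - g • Y‖ ^ 2 = (f * ‖X‖ - g * ‖Y‖) ^ 2
      + 2 * (f * g) * (‖X‖ * ‖Y‖ - frobInner X Y) := by
    rw [frobenius_norm_sq]
    simp only [frobInner_sub_left, frobInner_sub_right, frobInner_smul_right, frobInner_smul_left]
    rw [frobInner_comm Y X, ← frobenius_norm_sq, ← frobenius_norm_sq]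
    ring
  constructor
  · rw [e1, e2]
    have := mul_le_mul_of_nonneg_right (add_le_add hf hg) hXY
    linarith
  · rw [← sq_le_sq₀ (norm_nonneg _) (by positivity), mul_pow, e3, e1]
    have h4 : f * g ≤ 4 := by nlinarith
    have := mul_le_mul_of_nonneg_right h4 hXY
    linarith

/-- On skew parts the logarithm is radial, taking length `√2 sin θ` to `√2 θ`, so the one-variable
sine bounds feed `radial_bounds`. -/
theorem logSO3_sub_bounds {A B : Mat3} (hA : A ∈ SO3) (hB : B ∈ SO3)
    (hθA : rotAngle A ≤ 1 / 10) (hθB : rotAngle B ≤ 1 / 10) :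
    ‖skewPart (A - B)‖ ^ 2 ≤ frobInner (skewPart (A - B)) (logSO3 A - logSO3 B) ∧
      ‖logSO3 A - logSO3 B‖ ≤ 2 * ‖skewPart (A - B)‖ := by
  obtain ⟨f, hf, hf2, hLA, hfs⟩ := exists_logSO3_eq_smul hA hθA
  obtain ⟨g, hg, hg2, hLB, hgs⟩ := exists_logSO3_eq_smul hB hθB
  obtain ⟨h1, h2⟩ := sub_mul_sin_sub_sin_bounds (rotAngle_nonneg A) (rotAngle_nonneg B) hθA hθB
  have e : f * ‖skewPart A‖ - g * ‖skewPart B‖ = Real.sqrt 2 * (rotAngle A - rotAngle B) := by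
    rw [norm_skewPart_of_SO3 hA, norm_skewPart_of_SO3 hB]
    linear_combination Real.sqrt 2 * hfs - Real.sqrt 2 * hgs
  have e' : ‖skewPart A‖ - ‖skewPart B‖ =
      Real.sqrt 2 * (Real.sin (rotAngle A) - Real.sin (rotAngle B)) := by
    rw [norm_skewPart_of_SO3 hA, norm_skewPart_of_SO3 hB, mul_sub]
  have h2' := Real.mul_self_sqrt zero_le_two
  rw [skewPart_sub, hLA, hLB]
  apply radial_bounds hf hf2 hg hg2
  · rw [e, e', mul_mul_mul_comm, mul_pow, sq, h2']
    linarith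
  · rw [e, e', mul_pow, mul_pow, sq (Real.sqrt 2), h2']
    linarith

/-- Orthogonality makes the symmetric part second order: `AᵀA = BᵀB = 1` expresses it through
products of `A - B` with `A - 1` and `B - 1`. -/
theorem norm_symPart_sub_le {A B : Mat3} (hA : A ∈ SO3) (hB : B ∈ SO3) {δ : ℝ}
    (hA1 : ‖A - 1‖ ≤ δ) (hB1 : ‖B - 1‖ ≤ δ) : ‖symPart (A - B)‖ ≤ δ * ‖A - B‖ := by
  have e : symPart (A - B) = (-(1 / 2) : ℝ) • ((A - 1)ᵀ * (A - B) + (A - B)ᵀ * (B - 1)) := by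
    have : (A - 1)ᵀ * (A - B) + (A - B)ᵀ * (B - 1) = -((A - B) + (A - B)ᵀ) := by
      simp only [transpose_sub, transpose_one, Matrix.sub_mul, Matrix.mul_sub, hA.1, hB.1,
        Matrix.one_mul, Matrix.mul_one]
      abel
    rw [this, symPart]; module
  have h1 : ‖(A - 1)ᵀ * (A - B)‖ ≤ δ * ‖A - B‖ := by
    refine (frobenius_norm_mul _ _).trans ?_
    rw [frobenius_norm_transpose]; gcongr
  have h2 : ‖(A - B)ᵀ * (B - 1)‖ ≤ δ * ‖A - B‖ := by
    refine (frobenius_norm_mul _ _).trans ?_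
    rw [frobenius_norm_transpose, mul_comm]; gcongr
  rw [e, norm_smul]
  have := norm_add_le ((A - 1)ᵀ * (A - B)) ((A - B)ᵀ * (B - 1))
  rw [Real.norm_eq_abs, abs_neg, abs_of_pos one_half_pos]
  linarith

theorem norm_skewPart_sub_skewPart_le {A B : Mat3} {δ : ℝ} (hB1 : ‖B - 1‖ ≤ δ) :
    ‖skewPart (Bᵀ * A) - skewPart (A - B)‖ ≤ δ * ‖A - B‖ := by
  have e : skewPart (Bᵀ * A) - skewPart (A - B) = skewPart ((B - 1)ᵀ * (A - B)) := by
    simp only [skewPart, transpose_sub, transpose_mul, transpose_transpose, transpose_one,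
      Matrix.sub_mul, Matrix.mul_sub, Matrix.one_mul]
    module
  rw [e]
  refine (norm_skewPart_le _).trans ((frobenius_norm_mul _ _).trans ?_)
  rw [frobenius_norm_transpose]; gcongr

theorem trace_relative_mul_log_sub_ge {A B : Mat3} (hA : A ∈ SO3) (hB : B ∈ SO3)
    (hθA : rotAngle A ≤ 1 / 10) (hθB : rotAngle B ≤ 1 / 10)
    (hA1 : ‖A - 1‖ ≤ 1 / 10) (hB1 : ‖B - 1‖ ≤ 1 / 10) :
    3 / 4 * ‖A - B‖ ^ 2 ≤ (Bᵀ * A * (logSO3 B - logSO3 A)).trace := by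
  obtain ⟨h1, h2⟩ := logSO3_sub_bounds hA hB hθA hθB
  have hskew : (logSO3 B - logSO3 A)ᵀ = -(logSO3 B - logSO3 A) := by
    rw [transpose_sub, transpose_logSO3, transpose_logSO3]; abel
  have h3 : (Bᵀ * A * (logSO3 B - logSO3 A)).trace =
      frobInner (skewPart (A - B)) (logSO3 A - logSO3 B) +
      frobInner (skewPart (Bᵀ * A) - skewPart (A - B)) (logSO3 A - logSO3 B) := by
    rw [trace_mul_of_skew hskew]
    simp only [frobInner_sub_left, frobInner_sub_right]
    ring
  have h4 := (abs_le.mp (abs_frobInner_le (skewPart (Bᵀ * A) - skewPart (A - B))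
    (logSO3 A - logSO3 B))).1
  have h5 := mul_le_mul (norm_skewPart_sub_skewPart_le (A := A) hB1) h2 (norm_nonneg _)
    (by positivity)
  have h6 := norm_symPart_sub_le hA hB hA1 hB1
  have h7 := norm_sq_eq_skewPart_add_symPart (A - B)
  have h8 := norm_skewPart_le (A - B)
  have h9 : ‖symPart (A - B)‖ ^ 2 ≤ (1 / 10 * ‖A - B‖) ^ 2 := by gcongr
  have h10 := mul_le_mul_of_nonneg_left h8 (norm_nonneg (A - B))
  rw [h3]
  -- The skew part carries at least `0.99 ‖A - B‖²` and the error term costs at most `0.2 ‖A - B‖²`,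
  -- leaving more than `3/4`.
  nlinarith

/-! ### Bounds for velocities and the feedback term -/

theorem norm_toLp_mulVec_le (A : Mat3) (v : Vec3) :
    ‖(WithLp.toLp 2 (A *ᵥ WithLp.ofLp v) : Vec3)‖ ≤ ‖A‖ * ‖v‖ := by
  rw [← sq_le_sq₀ (norm_nonneg _) (by positivity), mul_pow, EuclideanSpace.norm_sq_eq,
    EuclideanSpace.norm_sq_eq, frobenius_norm_sq, frobInner_eq_sum, Finset.sum_mul]
  refine Finset.sum_le_sum fun i _ => ?_
  simp only [Real.norm_eq_abs, sq_abs, mulVec, dotProduct, ← sq]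
  exact Finset.sum_mul_sq_le_sq_mul_sq _ _ _

theorem transpose_hat (w : Vec3) : (hat w)ᵀ = -hat w := by
  ext i j; fin_cases i <;> fin_cases j <;> simp [hat]

theorem norm_hat (w : Vec3) : ‖hat w‖ = Real.sqrt 2 * ‖w‖ := by
  rw [← sq_eq_sq₀ (norm_nonneg _) (by positivity), mul_pow, Real.sq_sqrt zero_le_two,
    frobenius_norm_sq, frobInner_eq_sum, EuclideanSpace.norm_sq_eq]
  simp [hat, Fin.sum_univ_three]
  ring

theorem abs_trace_mul_hat_le {R : Mat3} (h : R ∈ SO3) (w : Vec3) :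
    |(R * hat w).trace| ≤ 2 * ‖w‖ * Real.sin (rotAngle R) := by
  rw [trace_mul_of_skew (transpose_hat w), abs_neg]
  refine (abs_frobInner_le _ _).trans (le_of_eq ?_)
  rw [norm_skewPart_of_SO3 h, norm_hat]
  linear_combination ‖w‖ * Real.sin (rotAngle R) * Real.mul_self_sqrt zero_le_two

theorem trace_mul_logSO3 {R : Mat3} (h : R ∈ SO3) :
    (R * logSO3 R).trace = -(2 * rotAngle R * Real.sin (rotAngle R)) := by
  rw [trace_mul_of_skew (transpose_logSO3 R), logSO3_eq_smul_skewPart, frobInner_smul_right,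
    ← frobenius_norm_sq, norm_skewPart_of_SO3 h, mul_pow, Real.sq_sqrt zero_le_two]
  by_cases hs : Real.sin (rotAngle R) = 0
  · simp [hs]
  · field_simp

/-! ### Scalar differential inequalities -/

theorem le_of_hasDerivWithinAt_nonneg {f f' : ℝ → ℝ} {t₀ a b : ℝ} (hta : t₀ ≤ a) (hab : a ≤ b)
    (hf : ∀ t, t₀ ≤ t → HasDerivWithinAt f (f' t) (Set.Ici t₀) t)
    (hnn : ∀ t ∈ Set.Ioc a b, 0 ≤ f' t) : f a ≤ f b := by
  have hcont : ContinuousOn f (Set.Icc a b) := fun t ht =>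
    ((hf t (hta.trans ht.1)).continuousWithinAt).mono fun s hs => hta.trans hs.1
  have hmono : MonotoneOn f (Set.Icc a b) := by
    apply monotoneOn_of_hasDerivWithinAt_nonneg (convex_Icc a b) hcont (f' := f')
    · intro t ht
      rw [interior_Icc] at ht ⊢
      exact (hf t (hta.trans ht.1.le)).mono fun s hs => hta.trans hs.1.le
    · intro t ht
      rw [interior_Icc] at ht
      exact hnn t ⟨ht.1, ht.2.le⟩
  exact hmono ⟨le_rfl, hab⟩ ⟨hab, le_rfl⟩ hab

/-- A superlevel set is forward invariant if the function does not decrease outside of it. -/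
theorem le_of_hasDerivWithinAt_of_lt {f f' : ℝ → ℝ} {t₀ C : ℝ}
    (hf : ∀ t, t₀ ≤ t → HasDerivWithinAt f (f' t) (Set.Ici t₀) t)
    (hC : ∀ t, t₀ ≤ t → f t < C → 0 ≤ f' t) (h0 : C ≤ f t₀) {t : ℝ} (ht : t₀ ≤ t) : C ≤ f t := by
  by_contra! hlt
  have hcont : ContinuousOn f (Set.Icc t₀ t) := fun s hs =>
    ((hf s hs.1).continuousWithinAt).mono fun r hr => hr.1
  have hcomp : IsCompact (Set.Icc t₀ t ∩ f ⁻¹' Set.Ici C) :=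
    isCompact_Icc.of_isClosed_subset (hcont.preimage_isClosed_of_isClosed isClosed_Icc isClosed_Ici)
      Set.inter_subset_left
  -- Take the last time `s` at which `f ≥ C`; afterwards `f < C`, so `f` cannot decrease from `s` to
  -- `t`.
  obtain ⟨s, ⟨hs, hsC⟩, hmax⟩ := hcomp.exists_isGreatest ⟨t₀, ⟨le_rfl, ht⟩, h0⟩
  have hle : f s ≤ f t := by
    refine le_of_hasDerivWithinAt_nonneg hs.1 hs.2 hf fun r hr => ?_
    refine hC r (hs.1.trans hr.1.le) ?_
    by_contra! hr'
    exact absurd (hmax ⟨⟨hs.1.trans hr.1.le, hr.2⟩, hr'⟩) (not_le.mpr hr.1)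
  exact absurd (lt_of_le_of_lt hle hlt) (not_lt.mpr hsC)

theorem le_mul_exp_of_hasDerivWithinAt {f f' : ℝ → ℝ} {t₀ r : ℝ}
    (hf : ∀ t, t₀ ≤ t → HasDerivWithinAt f (f' t) (Set.Ici t₀) t)
    (hle : ∀ t, t₀ ≤ t → f' t ≤ -r * f t) {t : ℝ} (ht : t₀ ≤ t) :
    f t ≤ f t₀ * Real.exp (-r * (t - t₀)) := by
  have hd : ∀ s, t₀ ≤ s → HasDerivWithinAt (fun s => -(f s * Real.exp (r * (s - t₀))))
      (-(f' s * Real.exp (r * (s - t₀)) + f s * (Real.exp (r * (s - t₀)) * (r * 1))))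
      (Set.Ici t₀) s := fun s hs =>
    ((hf s hs).mul ((((hasDerivWithinAt_id s _).sub_const t₀).const_mul r).exp)).neg
  have h := le_of_hasDerivWithinAt_nonneg le_rfl ht hd fun s hs => by
    have := mul_le_mul_of_nonneg_right (hle s hs.1.le) (Real.exp_pos (r * (s - t₀))).le
    linarith
  simp only [sub_self, mul_zero, Real.exp_zero, mul_one, neg_le_neg_iff] at h
  have h2 := mul_le_mul_of_nonneg_right h (Real.exp_pos (-r * (t - t₀))).le
  rwa [mul_assoc, ← Real.exp_add, neg_mul, add_neg_cancel, Real.exp_zero, mul_one, ← neg_mul] at h2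

/-! ### Evolution of the errors and of the relative attitude -/

theorem hasDerivWithinAt_trace_transpose_mul {A B : ℝ → Mat3} {A' B' : Mat3} {s : Set ℝ} {t : ℝ}
    (hA : ∀ a b, HasDerivWithinAt (fun s => A s a b) (A' a b) s t)
    (hB : ∀ a b, HasDerivWithinAt (fun s => B s a b) (B' a b) s t) :
    HasDerivWithinAt (fun s => ((A s)ᵀ * B s).trace)
      ((A'ᵀ * B t).trace + ((A t)ᵀ * B').trace) s t := by
  have e : ∀ X Y : Mat3, (Xᵀ * Y).trace = ∑ i, ∑ j, X i j * Y i j := frobInner_eq_sum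
  simp only [e, ← Finset.sum_add_distrib]
  exact HasDerivWithinAt.fun_sum fun i _ => HasDerivWithinAt.fun_sum fun j _ =>
    (hA i j).mul (hB i j)

theorem trace_error_deriv {Ra R : Mat3} (hRa : Ra ∈ SO3) (hR : R ∈ SO3) (k : ℝ) (wu wk : Vec3) :
    ((Ra * (hat wu + hat wk))ᵀ * R).trace + (Raᵀ * (R * controlLaw k Ra R (hat wk))).trace =
      -((Raᵀ * R) * hat wu).trace - k * ((Raᵀ * R) * logSO3 (Raᵀ * R)).trace := by
  have hE := SO3_mul_transpose (SO3_transpose_mul_mem hRa hR)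
  have h1 : (Ra * (hat wu + hat wk))ᵀ * R = -(hat wu * (Raᵀ * R)) - hat wk * (Raᵀ * R) := by
    rw [transpose_mul, transpose_add, transpose_hat, transpose_hat, Matrix.mul_assoc]
    noncomm_ring
  have h2 : Raᵀ * (R * controlLaw k Ra R (hat wk)) =
      -(k • ((Raᵀ * R) * logSO3 (Raᵀ * R))) + hat wk * (Raᵀ * R) := by
    rw [← Matrix.mul_assoc, controlLaw, adjointMap, Matrix.mul_add, transpose_transpose,
      Matrix.mul_assoc (Raᵀ * R)ᵀ, ← Matrix.mul_assoc (Raᵀ * R) (Raᵀ * R)ᵀ, hE, Matrix.one_mul,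
      Matrix.mul_neg, Matrix.mul_smul]
  rw [h1, h2, trace_sub, trace_add, trace_neg, trace_neg, trace_smul, trace_mul_comm (hat wu),
    smul_eq_mul]
  ring

/-- Seen in the target frame, `Ad` turns the known velocity into the same matrix for both robots, so
its two contributions cancel; only the feedback remains. -/
theorem trace_relative_deriv {Ra Ri Rj : Mat3} (hRa : Ra ∈ SO3) (hRi : Ri ∈ SO3) (hRj : Rj ∈ SO3)
    (k : ℝ) (wk : Vec3) :
    ((Rj * controlLaw k Ra Rj (hat wk))ᵀ * Ri).trace +
        (Rjᵀ * (Ri * controlLaw k Ra Ri (hat wk))).trace =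
      k * (((Raᵀ * Rj)ᵀ * (Raᵀ * Ri)) * (logSO3 (Raᵀ * Rj) - logSO3 (Raᵀ * Ri))).trace := by
  have hrel : Rjᵀ * Ri = (Raᵀ * Rj)ᵀ * (Raᵀ * Ri) := by
    rw [transpose_mul, transpose_transpose, Matrix.mul_assoc, ← Matrix.mul_assoc Ra,
      SO3_mul_transpose hRa, Matrix.one_mul]
  have hA := SO3_mul_transpose (SO3_transpose_mul_mem hRa hRi)
  have hB := SO3_mul_transpose (SO3_transpose_mul_mem hRa hRj)
  rw [transpose_mul, Matrix.mul_assoc _ Rjᵀ, ← Matrix.mul_assoc Rjᵀ, hrel]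
  simp only [controlLaw, adjointMap]
  have hW := transpose_hat wk
  generalize Raᵀ * Ri = A at hA ⊢
  generalize Raᵀ * Rj = B at hB ⊢
  generalize hat wk = W at hW ⊢
  have h1 : (-(k • logSO3 B) + Bᵀ * W * Bᵀᵀ)ᵀ * (Bᵀ * A) =
      k • (logSO3 B * (Bᵀ * A)) - Bᵀ * (W * A) := by
    rw [transpose_add, transpose_neg, transpose_smul, transpose_logSO3, transpose_mul,
      transpose_mul, hW, transpose_transpose, transpose_transpose, Matrix.add_mul]
    simp only [smul_neg, neg_neg, Matrix.smul_mul, Matrix.mul_assoc, Matrix.neg_mul,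
      Matrix.mul_neg, sub_eq_add_neg]
    rw [← Matrix.mul_assoc B, hB, Matrix.one_mul]
  have h2 : Bᵀ * A * (-(k • logSO3 A) + Aᵀ * W * Aᵀᵀ) =
      -(k • (Bᵀ * A * logSO3 A)) + Bᵀ * (W * A) := by
    rw [Matrix.mul_add, transpose_transpose, Matrix.mul_neg, Matrix.mul_smul]
    simp only [Matrix.mul_assoc]
    rw [← Matrix.mul_assoc A, hA, Matrix.one_mul]
  rw [h1, h2, Matrix.mul_sub, trace_sub, trace_sub, trace_add, trace_neg, trace_smul, trace_smul,
    trace_mul_comm (logSO3 B)]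
  simp only [smul_eq_mul]
  ring

/-- Invariance of the sublevel sets of the attitude error. -/
theorem rotAngle_error_le {t₀ ωd k θ₀ : ℝ} {v : Vec3} {wu wk : ℝ → Vec3} {Ra R : ℝ → Mat3}
    {p : ℝ → Vec3} (hk : 0 ≤ k) (hT : IsTarget t₀ ωd wu wk Ra)
    (hR : IsControlledRobot t₀ k v wk Ra p R) (hωk : ωd ≤ k * θ₀) (hθ0 : 0 ≤ θ₀)
    (hθpi : θ₀ ≤ Real.pi) (h0 : rotAngle ((Ra t₀)ᵀ * R t₀) ≤ θ₀) {t : ℝ} (ht : t₀ ≤ t) :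
    rotAngle ((Ra t)ᵀ * R t) ≤ θ₀ := by
  have hSO : ∀ s, t₀ ≤ s → (Ra s)ᵀ * R s ∈ SO3 := fun s hs =>
    SO3_transpose_mul_mem (hT.mem_SO3 s hs) (hR.mem_SO3 s hs)
  have hiff : ∀ s, t₀ ≤ s → (1 + 2 * Real.cos θ₀ ≤ ((Ra s)ᵀ * R s).trace ↔
      rotAngle ((Ra s)ᵀ * R s) ≤ θ₀) := fun s hs => by
    rw [trace_eq_of_SO3 (hSO s hs), add_le_add_iff_left, mul_le_mul_iff_right₀ two_pos,
      Real.strictAntiOn_cos.le_iff_ge ⟨hθ0, hθpi⟩ ⟨rotAngle_nonneg _, rotAngle_le_pi _⟩]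
  rw [← hiff t ht]
  refine le_of_hasDerivWithinAt_of_lt (f := fun s => ((Ra s)ᵀ * R s).trace)
    (f' := fun s => -((Ra s)ᵀ * R s * hat (wu s)).trace
      - k * ((Ra s)ᵀ * R s * logSO3 ((Ra s)ᵀ * R s)).trace)
    (fun s hs => ?_) (fun s hs hlt => ?_) ((hiff t₀ le_rfl).mpr h0) ht
  · rw [← trace_error_deriv (hT.mem_SO3 s hs) (hR.mem_SO3 s hs) k (wu s) (wk s)]
    exact hasDerivWithinAt_trace_transpose_mul (hT.deriv_eq s hs) (hR.deriv_attitude s hs)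
  · have hlt' : θ₀ < rotAngle ((Ra s)ᵀ * R s) := by
      rw [← not_le, ← hiff s hs]; exact not_le.mpr hlt
    have h1 := (abs_le.mp (abs_trace_mul_hat_le (hSO s hs) (wu s))).2
    have h2 := sin_rotAngle_nonneg ((Ra s)ᵀ * R s)
    -- Outside the ball the feedback dominates the unknown drift; both carry the common factor `2
    -- sin θ`.
    have h3 : ‖wu s‖ ≤ k * rotAngle ((Ra s)ᵀ * R s) :=
      (hT.unknown_le s hs).trans (hωk.trans (mul_le_mul_of_nonneg_left hlt'.le hk))
    have h4 := mul_le_mul_of_nonneg_right h3 h2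
    rw [trace_mul_logSO3 (hSO s hs)]
    linarith

theorem norm_error_sub_error {Ra : Mat3} (hRa : Ra ∈ SO3) (Ri Rj : Mat3) :
    ‖Raᵀ * Ri - Raᵀ * Rj‖ = ‖Ri - Rj‖ := by
  rw [← sq_eq_sq₀ (norm_nonneg _) (norm_nonneg _), frobenius_norm_sq, frobenius_norm_sq,
    ← Matrix.mul_sub, frobInner, frobInner, transpose_mul, transpose_transpose, Matrix.mul_assoc,
    ← Matrix.mul_assoc Ra, SO3_mul_transpose hRa, Matrix.one_mul]

/-- Exponential decay of the chordal distance of two robots close to the target. -/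
theorem norm_relative_sq_le {t₀ ωd k : ℝ} {v : Vec3} {wu wk : ℝ → Vec3} {Ra Ri Rj : ℝ → Mat3}
    {pi pj : ℝ → Vec3} (hk : 0 ≤ k) (hT : IsTarget t₀ ωd wu wk Ra)
    (hRi : IsControlledRobot t₀ k v wk Ra pi Ri) (hRj : IsControlledRobot t₀ k v wk Ra pj Rj)
    (hi : ∀ t, t₀ ≤ t → Real.sqrt 2 * rotAngle ((Ra t)ᵀ * Ri t) ≤ 1 / 10)
    (hj : ∀ t, t₀ ≤ t → Real.sqrt 2 * rotAngle ((Ra t)ᵀ * Rj t) ≤ 1 / 10)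
    {t : ℝ} (ht : t₀ ≤ t) :
    ‖Ri t - Rj t‖ ^ 2 ≤ ‖Ri t₀ - Rj t₀‖ ^ 2 * Real.exp (-(3 / 2 * k) * (t - t₀)) := by
  have hbound : ∀ x : ℝ, 0 ≤ x → Real.sqrt 2 * x ≤ 1 / 10 → x ≤ 1 / 10 := fun x hx h =>
    (le_mul_of_one_le_left hx (Real.one_le_sqrt.mpr one_le_two)).trans h
  have hsq : ∀ s, t₀ ≤ s → ‖Ri s - Rj s‖ ^ 2 = 2 * (3 - ((Rj s)ᵀ * Ri s).trace) := fun s hs =>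
    norm_sub_sq_of_SO3 (hRi.mem_SO3 s hs) (hRj.mem_SO3 s hs)
  have hd : ∀ s, t₀ ≤ s → HasDerivWithinAt (fun s => 3 - ((Rj s)ᵀ * Ri s).trace)
      (-(k * ((((Ra s)ᵀ * Rj s)ᵀ * ((Ra s)ᵀ * Ri s)) *
        (logSO3 ((Ra s)ᵀ * Rj s) - logSO3 ((Ra s)ᵀ * Ri s))).trace)) (Set.Ici t₀) s := by
    intro s hs
    rw [← trace_relative_deriv (hT.mem_SO3 s hs) (hRi.mem_SO3 s hs) (hRj.mem_SO3 s hs) k (wk s)]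
    exact (hasDerivWithinAt_trace_transpose_mul (hRj.deriv_attitude s hs)
      (hRi.deriv_attitude s hs)).const_sub 3
  have h := le_mul_exp_of_hasDerivWithinAt (r := 3 / 2 * k) hd (fun s hs => ?_) ht
  · rw [hsq t ht, hsq t₀ le_rfl, mul_assoc]
    exact mul_le_mul_of_nonneg_left h zero_le_two
  · have hA := SO3_transpose_mul_mem (hT.mem_SO3 s hs) (hRi.mem_SO3 s hs)
    have hB := SO3_transpose_mul_mem (hT.mem_SO3 s hs) (hRj.mem_SO3 s hs)
    have h1 := trace_relative_mul_log_sub_ge hA hB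
      (hbound _ (rotAngle_nonneg _) (hi s hs)) (hbound _ (rotAngle_nonneg _) (hj s hs))
      ((norm_sub_one_le_of_SO3 hA).trans (hi s hs)) ((norm_sub_one_le_of_SO3 hB).trans (hj s hs))
    rw [norm_error_sub_error (hT.mem_SO3 s hs), hsq s hs] at h1
    have h2 := mul_le_mul_of_nonneg_left h1 hk
    linarith

/-! ### Relative position and return to angles -/

theorem norm_relative_position_le {t₀ k C r : ℝ} {v : Vec3} {wk : ℝ → Vec3} {Ra Ri Rj : ℝ → Mat3}
    {pi pj : ℝ → Vec3} (hr : 0 < r) (hv : ‖v‖ = 1) (hC : 0 ≤ C)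
    (hRi : IsControlledRobot t₀ k v wk Ra pi Ri) (hRj : IsControlledRobot t₀ k v wk Ra pj Rj)
    (hle : ∀ t, t₀ ≤ t → ‖Ri t - Rj t‖ ≤ C * Real.exp (-r * (t - t₀))) {t : ℝ} (ht : t₀ ≤ t) :
    ‖(pi t - pj t) - (pi t₀ - pj t₀)‖ ≤ C / r := by
  have hd : ∀ s, t₀ ≤ s → HasDerivWithinAt (fun s => (pi s - pj s) - (pi t₀ - pj t₀))
      (WithLp.toLp 2 ((Ri s - Rj s) *ᵥ WithLp.ofLp v)) (Set.Ici t₀) s := fun s hs => by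
    rw [Matrix.sub_mulVec, WithLp.toLp_sub]
    exact ((hRi.deriv_position s hs).sub (hRj.deriv_position s hs)).sub_const _
  -- Comparison function: the integral of the speed bound `C exp(-r (s - t₀))` from `t₀`.
  have hB : ∀ s, HasDerivAt (fun s => C / r * (1 - Real.exp (-r * (s - t₀))))
      (C * Real.exp (-r * (s - t₀))) s := fun s => by
    have h := (((((hasDerivAt_id s).sub_const t₀).const_mul (-r)).exp).const_sub 1).const_mul (C / r)
    refine h.congr_deriv ?_
    simp only [id]
    field_simp
  have h := image_norm_le_of_norm_deriv_right_le_deriv_boundary (a := t₀) (b := t)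
    (fun s hs => ((hd s hs.1).continuousWithinAt).mono fun x hx => hx.1)
    (fun s hs => (hd s hs.1).mono fun x hx => hs.1.trans hx) (by simp) hB
    (fun s hs => (norm_toLp_mulVec_le _ _).trans (by rw [hv, mul_one]; exact hle s hs.1))
    (Set.right_mem_Icc.mpr ht)
  refine h.trans ?_
  have : C / r * (1 - Real.exp (-r * (t - t₀))) = C / r - C / r * Real.exp (-r * (t - t₀)) := by ring
  rw [this]
  exact sub_le_self _ (by positivity)

theorem norm_sub_le_of_rotAngle_error_le {Ra Ri Rj : Mat3} {δ : ℝ} (hRa : Ra ∈ SO3) (hRi : Ri ∈ SO3)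
    (hRj : Rj ∈ SO3) (hi : Real.sqrt 2 * rotAngle (Raᵀ * Ri) ≤ δ)
    (hj : Real.sqrt 2 * rotAngle (Raᵀ * Rj) ≤ δ) : ‖Ri - Rj‖ ≤ 2 * δ := by
  have h1 := (norm_sub_one_le_of_SO3 (SO3_transpose_mul_mem hRa hRi)).trans hi
  have h2 := (norm_sub_one_le_of_SO3 (SO3_transpose_mul_mem hRa hRj)).trans hj
  rw [← norm_error_sub_error hRa, ← sub_sub_sub_cancel_right _ _ (1 : Mat3)]
  linarith [norm_sub_le (Raᵀ * Ri - 1) (Raᵀ * Rj - 1)]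

/-- Trace `-1` would force `‖Ri - Rj‖² = 8`, while the triangle inequality through the target allows
at most `4`. -/
theorem trace_relative_ne_neg_one {Ra Ri Rj : Mat3} {δ : ℝ} (hRa : Ra ∈ SO3) (hRi : Ri ∈ SO3)
    (hRj : Rj ∈ SO3) (hi : Real.sqrt 2 * rotAngle (Raᵀ * Ri) ≤ δ)
    (hj : Real.sqrt 2 * rotAngle (Raᵀ * Rj) ≤ δ) (hδ : δ ≤ 1) : (Rjᵀ * Ri).trace ≠ -1 := by
  intro htr
  have h1 := (norm_sub_le_of_rotAngle_error_le hRa hRi hRj hi hj).trans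
    (mul_le_mul_of_nonneg_left hδ zero_le_two)
  have h2 := norm_sub_sq_of_SO3 hRi hRj
  have h3 := pow_le_pow_left₀ (norm_nonneg _) h1 2
  rw [htr] at h2
  linarith

theorem norm_le_mul_exp_of_sq_le {X Y : Mat3} {C x : ℝ} (h : ‖X‖ ^ 2 ≤ ‖Y‖ ^ 2 * Real.exp (2 * x))
    (hY : ‖Y‖ ≤ C) : ‖X‖ ≤ C * Real.exp x := by
  have hC := (norm_nonneg Y).trans hY
  rw [← sq_le_sq₀ (norm_nonneg _) (by positivity), mul_pow, ← Real.exp_nat_mul]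
  exact h.trans (mul_le_mul_of_nonneg_right (pow_le_pow_left₀ (norm_nonneg _) hY 2)
    (Real.exp_pos _).le)

theorem rotAngle_le_mul_exp {A B A₀ B₀ : Mat3} (hA : A ∈ SO3) (hB : B ∈ SO3) (hA₀ : A₀ ∈ SO3)
    (hB₀ : B₀ ∈ SO3) {x : ℝ}
    (h : ‖A - B‖ ^ 2 ≤ ‖A₀ - B₀‖ ^ 2 * Real.exp (2 * x)) :
    rotAngle (Bᵀ * A) ≤ Real.pi / 2 * rotAngle (B₀ᵀ * A₀) * Real.exp x := by
  rw [norm_sub_sq_of_SO3 hA hB, norm_sub_sq_of_SO3 hA₀ hB₀] at h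
  have h1 := rotAngle_sq_le (SO3_transpose_mul_mem hB hA)
  have h2 := sub_trace_le_rotAngle_sq (SO3_transpose_mul_mem hB₀ hA₀)
  have h3 := mul_le_mul_of_nonneg_right h2 (Real.exp_pos (2 * x)).le
  have h4 : 3 - (Bᵀ * A).trace ≤ rotAngle (B₀ᵀ * A₀) ^ 2 * Real.exp (2 * x) := by linarith
  have h5 := rotAngle_nonneg (B₀ᵀ * A₀)
  have hpi := Real.pi_pos
  rw [← sq_le_sq₀ (rotAngle_nonneg _) (by positivity), mul_pow, mul_pow, ← Real.exp_nat_mul,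
    mul_assoc]
  exact h1.trans (mul_le_mul_of_nonneg_left (by exact_mod_cast h4) (sq_nonneg _))

end

/-! ### Choice of constants and conclusion -/

theorem mainTheorem6 :
    ∃ δ₀ > (0 : ℝ), ∃ α > (0 : ℝ), ∃ c > (0 : ℝ),
      ∀ (δs μs ωd k t₀ : ℝ) (v : Vec3) (wu wk : ℝ → Vec3) (Ra Ri Rj : ℝ → Mat3)
        (pi pj : ℝ → Vec3),
        0 < ωd → 0 < μs → μs ≤ δs → δs ≤ δ₀ →
        k = Real.sqrt 2 * ωd / μs →
        ‖v‖ = 1 →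
        IsTarget t₀ ωd wu wk Ra →
        IsControlledRobot t₀ k v wk Ra pi Ri →
        IsControlledRobot t₀ k v wk Ra pj Rj →
        -- both robots start in the target set, with attitude errors at most `δs`
        Ri t₀ ∈ targetSet (Ra t₀) δs → Rj t₀ ∈ targetSet (Ra t₀) δs →
        ((Ra t₀)ᵀ * Ri t₀).trace ≠ -1 → ((Ra t₀)ᵀ * Rj t₀).trace ≠ -1 →
        distSO3 (Ra t₀) (Ri t₀) ≤ δs → distSO3 (Ra t₀) (Rj t₀) ≤ δs →
        (∀ t, t₀ ≤ t →
          ((Rj t)ᵀ * Ri t).trace ≠ -1 ∧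
          frobNorm (logSO3 ((Rj t)ᵀ * Ri t)) ≤
            α * frobNorm (logSO3 ((Rj t₀)ᵀ * Ri t₀)) * Real.exp (-(c * k) * (t - t₀))) ∧
        (distSO3 (Ra t₀) (Ri t₀) ≤ μs → distSO3 (Ra t₀) (Rj t₀) ≤ μs →
          ∀ t, t₀ ≤ t →
          ‖(pi t - pj t) - (pi t₀ - pj t₀)‖ ≤ 2 * Real.sqrt 3 * μs / k) := by
  refine ⟨1 / 10, by norm_num, Real.pi / 2, by positivity, 3 / 4, by norm_num, ?_⟩
  intro δs μs ωd k t₀ v wu wk Ra Ri Rj pi pj hω hμ hμδ hδ hk hv hT hRi hRj _ _ htri htrj hdi hdj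
  have hk0 : 0 < k := by rw [hk]; positivity
  have hs2 : (0 : ℝ) < Real.sqrt 2 := by positivity
  have hRa := hT.mem_SO3 t₀ le_rfl
  have hi0 := SO3_transpose_mul_mem hRa (hRi.mem_SO3 t₀ le_rfl)
  have hj0 := SO3_transpose_mul_mem hRa (hRj.mem_SO3 t₀ le_rfl)
  rw [distSO3, frobNorm_logSO3 hi0 htri] at hdi ⊢
  rw [distSO3, frobNorm_logSO3 hj0 htrj] at hdj ⊢
  have hθ0 : 0 ≤ δs / Real.sqrt 2 := div_nonneg (hμ.le.trans hμδ) hs2.le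
  have hθpi : δs / Real.sqrt 2 ≤ Real.pi :=
    (div_le_self (hμ.le.trans hμδ) (Real.one_le_sqrt.mpr one_le_two)).trans
      (by linarith [Real.pi_gt_three])
  -- With `k = √2 ωd / μs`, the invariant angle `δs / √2` gives exactly `ωd δs / μs`; this is where
  -- `μs ≤ δs` is needed.
  have hωk : ωd ≤ k * (δs / Real.sqrt 2) := by
    have : k * (δs / Real.sqrt 2) = ωd * (δs / μs) := by rw [hk]; field_simp
    rw [this]
    exact le_mul_of_one_le_right hω.le ((one_le_div hμ).mpr hμδ)
  have hinv : ∀ (p : ℝ → Vec3) (R : ℝ → Mat3), IsControlledRobot t₀ k v wk Ra p R →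
      Real.sqrt 2 * rotAngle ((Ra t₀)ᵀ * R t₀) ≤ δs → ∀ t, t₀ ≤ t →
      Real.sqrt 2 * rotAngle ((Ra t)ᵀ * R t) ≤ δs := fun p R hR h0 t ht =>
    (le_div_iff₀' hs2).mp
      (rotAngle_error_le hk0.le hT hR hωk hθ0 hθpi ((le_div_iff₀' hs2).mpr h0) ht)
  have hi := hinv pi Ri hRi hdi
  have hj := hinv pj Rj hRj hdj
  have hdecay := fun t (ht : t₀ ≤ t) => norm_relative_sq_le hk0.le hT hRi hRj
    (fun s hs => (hi s hs).trans hδ) (fun s hs => (hj s hs).trans hδ) ht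
  have htr : ∀ t, t₀ ≤ t → ((Rj t)ᵀ * Ri t).trace ≠ -1 := fun t ht =>
    trace_relative_ne_neg_one (hT.mem_SO3 t ht) (hRi.mem_SO3 t ht) (hRj.mem_SO3 t ht)
      (hi t ht) (hj t ht) (by linarith)
  have hexp : ∀ t, -(3 / 2 * k) * (t - t₀) = 2 * (-(3 / 4 * k) * (t - t₀)) := fun t => by ring
  constructor
  · intro t ht
    refine ⟨htr t ht, ?_⟩
    have h := hdecay t ht
    rw [hexp] at h
    rw [frobNorm_logSO3 (SO3_transpose_mul_mem (hRj.mem_SO3 t ht) (hRi.mem_SO3 t ht)) (htr t ht),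
      frobNorm_logSO3 (SO3_transpose_mul_mem (hRj.mem_SO3 t₀ le_rfl) (hRi.mem_SO3 t₀ le_rfl))
        (htr t₀ le_rfl)]
    have h1 := mul_le_mul_of_nonneg_left (rotAngle_le_mul_exp (hRi.mem_SO3 t ht) (hRj.mem_SO3 t ht)
      (hRi.mem_SO3 t₀ le_rfl) (hRj.mem_SO3 t₀ le_rfl) h) hs2.le
    linarith
  · intro hμi hμj t ht
    have h0 := norm_sub_le_of_rotAngle_error_le hRa (hRi.mem_SO3 t₀ le_rfl) (hRj.mem_SO3 t₀ le_rfl) hμi hμj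
    have h := norm_relative_position_le (r := 3 / 4 * k) (C := 2 * μs) (by positivity) hv
      (by positivity) hRi hRj (fun s hs => ?_) ht
    · refine h.trans ?_
      -- Integration yields `2 μs / (3/4 k)`, so the constant `√3` has room to spare over `4/3`.
      have h3 : (4 / 3 : ℝ) ≤ Real.sqrt 3 := Real.le_sqrt_of_sq_le (by norm_num)
      have e : 2 * μs / (3 / 4 * k) = 2 * (4 / 3) * μs / k := by field_simp
      rw [e]
      gcongr
    · have h1 := hdecay s hs
      rw [hexp] at h1
      exact norm_le_mul_exp_of_sq_le h1 h0
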